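/- Let $A$ be a complex unital Banach algebra with unit $e$ and let $a\in A$. Write $\sigma(a)$ for the spectrum of $a$, and $L_a,R_a\colon A\to A$ for the bounded operators $L_a(x)=ax$, $R_a(x)=xa$. An element $x\in A$ is Drazin invertible if there exist $b\in A$ and $m\in\mathbb N$ with $x^mbx=x^m$, $bxb=b$ and $xb=bx$; the Drazin spectrum is $\sigma_{\mathcal{DR}}(a)=\{\lambda\in\mathbb C: a-\lambda e \text{ is not Drazin invertible}\}$. For a bounded operator $T$ on a complex Banach space with range $R(T)$ and null space $N(T)$, let $d(T)=\inf\{n\ge 0: R(T^n)=R(T^{n+1})\}$ be its descent and $a(T)=\inf\{n\ge 0: N(T^n)=N(T^{n+1})\}$ its ascent, with $\inf\emptyset=\infty$. Define the left Drazin spectrum $\sigma_{\mathcal{LD}}(T)$, the right Drazin spectrum $\sigma_{\mathcal{RD}}(T)$ and the descent spectrum $\sigma_{dsc}(T)$ as the sets of $\lambda\in\mathbb C$ for which $S=T-\lambda I$ does not satisfy, respectively: $a(S)<\infty$ and $R(S^{a(S)+1})$ is closed; $d(S)<\infty$ and $R(S^{d(S)})$ is closed; $d(S)<\infty$. Then the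 following statements are equivalent: (i) $\sigma(a)$ is at most countable; (ii) $\sigma_{\mathcal{DR}}(a)$ is at most countable. Furthermore, in this case $$\sigma_{\mathcal{DR}}(a)=\sigma_{\mathcal{LD}}(L_a)=\sigma_{\mathcal{RD}}(L_a)=\sigma_{dsc}(L_a)=\sigma_{\mathcal{LD}}(R_a)=\sigma_{\mathcal{RD}}(R_a)=\sigma_{dsc}(R_a).$$ -/

import Mathlib

/-- An element `a` of a ring is Drazin invertible if there are `b` and `m` with
`a ^ m * b * a = a ^ m`, `b * a * b = b` and `a * b = b * a`. -/
def IsDrazinInvertible {A : Type*} [Ring A] (a : A) : Prop :=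
  ∃ (b : A) (m : ℕ), a ^ m * b * a = a ^ m ∧ b * a * b = b ∧ a * b = b * a

/-- The spectrum of `a` derived from a set `R` of elements of a complex algebra:
all complex `z` such that `a - z` does not belong to `R`. -/
def derivedSpectrum {A : Type*} [Ring A] [Algebra ℂ A] (R : Set A) (a : A) : Set ℂ :=
  {z : ℂ | a - algebraMap ℂ A z ∉ R}

/-- The Drazin spectrum of an element of a complex algebra. -/
def drazinSpectrum {A : Type*} [Ring A] [Algebra ℂ A] (a : A) : Set ℂ :=
  derivedSpectrum {x : A | IsDrazinInvertible x} a

section Operators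

variable {X : Type*} [NormedAddCommGroup X] [NormedSpace ℂ X]

/-- The descent of `T`: the infimum of all `n` with `R(T ^ n) = R(T ^ (n + 1))`,
which is `⊤` if there is no such `n`. -/
noncomputable def opDescent (T : X →L[ℂ] X) : ℕ∞ :=
  ⨅ (n : ℕ) (_ : Set.range ⇑(T ^ n) = Set.range ⇑(T ^ (n + 1))), (n : ℕ∞)

/-- The ascent of `T`: the infimum of all `n` with `N(T ^ n) = N(T ^ (n + 1))`,
which is `⊤` if there is no such `n`. -/
noncomputable def opAscent (T : X →L[ℂ] X) : ℕ∞ :=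
  ⨅ (n : ℕ) (_ : {x : X | (T ^ n) x = 0} = {x : X | (T ^ (n + 1)) x = 0}), (n : ℕ∞)

/-- `T` is left Drazin invertible: its ascent `p` is finite and `R(T ^ (p + 1))` is closed. -/
def IsLeftDrazin (T : X →L[ℂ] X) : Prop :=
  ∃ p : ℕ, opAscent T = (p : ℕ∞) ∧ IsClosed (Set.range ⇑(T ^ (p + 1)))

/-- `T` is right Drazin invertible: its descent `q` is finite and `R(T ^ q)` is closed. -/
def IsRightDrazin (T : X →L[ℂ] X) : Prop :=
  ∃ q : ℕ, opDescent T = (q : ℕ∞) ∧ IsClosed (Set.range ⇑(T ^ q))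

/-- The left Drazin spectrum of a bounded operator. -/
def leftDrazinSpectrum (T : X →L[ℂ] X) : Set ℂ :=
  derivedSpectrum {S : X →L[ℂ] X | IsLeftDrazin S} T

/-- The right Drazin spectrum of a bounded operator. -/
def rightDrazinSpectrum (T : X →L[ℂ] X) : Set ℂ :=
  derivedSpectrum {S : X →L[ℂ] X | IsRightDrazin S} T

/-- The descent spectrum of a bounded operator. -/
def descentSpectrum (T : X →L[ℂ] X) : Set ℂ :=
  derivedSpectrum {S : X →L[ℂ] X | opDescent S < ⊤} T

end Operators

section Multiplication

variable {A : Type*} [NormedRing A] [NormedAlgebra ℂ A]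

/-- Left multiplication `L_a x = a * x` as a bounded operator. -/
noncomputable def leftMulOp (a : A) : A →L[ℂ] A :=
  ContinuousLinearMap.mul ℂ A a

/-- Right multiplication `R_a x = x * a` as a bounded operator. -/
noncomputable def rightMulOp (a : A) : A →L[ℂ] A :=
  (ContinuousLinearMap.mul ℂ A).flip a

end Multiplication

/-!
The Drazin spectrum differs from the spectrum by isolated points only: if `x` has Drazin inverse `b`,
then `x` is the sum of an invertible part and a nilpotent part (cut out by the idempotent `x * b`), so
`x - μ` is invertible for all small `μ ≠ 0` (`IsDrazinInvertible.eventually_isUnit_sub`). Since a discrete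
subset of `ℂ` is countable, both spectra are countable at the same time.

A Drazin inverse of `x` gives one of `L_x` and of `R_x`, and a Drazin invertible operator `T` has finite
ascent and descent, with range and kernel of high powers the range and kernel of the bounded projection
`T * B`. This is why the operator spectra are contained in the Drazin spectrum.

For the converse, countability of the spectrum makes the resolvent set dense, so that `S = L_x` (or
`R_x`), with `x = a - z`, is a limit of invertible operators `S - μ`. Two perturbation arguments use this:

* if `S` has ascent `p` and `R(S ^ (p + 1))` is closed, the open mapping theorem makes `S` bounded below
  on `R(S ^ p)`, and the inverses of `S - μ` then produce approximate solutions of `S z = y` there, so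
  `R(S ^ p) = R(S ^ (p + 1))` (`exists_range_ker_eq_of_isLeftDrazin`);
* if `R(S ^ d) = R(S ^ (d + 1))`, an element `u` of `N(S ^ (d + 1))` extends to a power series
  `v(μ) = ∑ μ ^ k u_k` of elements with `S ^ d (S - μ) v(μ) = 0`; so `S ^ d v(μ) = 0` for a sequence
  `μ → 0`, and `u ∈ N(S ^ d)` (`pow_apply_eq_zero_of_range_eq`).

In either case ranges and kernels of the powers of `S` both stabilise, which for a multiplication
operator is an algebraic statement about `x` yielding an explicit Drazin inverse
(`isDrazinInvertible_of_pow_eq`).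
-/

open Filter Topology

/-! ### Drazin invertible elements of a ring -/

/-- If the powers of left multiplication by `x` have stable range and stable kernel from `p` on, then
`x` is Drazin invertible; writing `x ^ p = x ^ (2 * p + 1) * d`, the inverse is `x ^ p * d`. -/
theorem isDrazinInvertible_of_pow_eq {R : Type*} [Ring R] {x c : R} {p : ℕ}
    (hc : x ^ p = x ^ (p + 1) * c)
    (hk : ∀ y, x ^ (p + 1) * y = 0 → x ^ p * y = 0) : IsDrazinInvertible x := by
  have hit : ∀ k : ℕ, x ^ p = x ^ (p + k) * c ^ k := by
    intro k
    induction k with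
    | zero => simp
    | succ k ih =>
      calc x ^ p = x ^ k * x ^ p * c ^ k := by rw [← pow_add, add_comm k p, ← ih]
        _ = x ^ (p + (k + 1)) * c ^ (k + 1) := by
          rw [hc, ← mul_assoc, ← pow_add, mul_assoc, ← pow_succ']
          congr 2; omega
  have hkk : ∀ k : ℕ, ∀ y, x ^ (p + k) * y = 0 → x ^ p * y = 0 := by
    intro k
    induction k with
    | zero => exact fun y hy => hy
    | succ k ih =>
      intro y hy
      have h1 : x ^ (p + 1) * (x ^ k * y) = 0 := by
        rw [← mul_assoc, ← pow_add, ← hy]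
        congr 2; omega
      have h2 := hk _ h1
      rw [← mul_assoc, ← pow_add] at h2
      exact ih _ h2
  obtain ⟨d, hd⟩ : ∃ d, x ^ (p + (p + 1)) * d = x ^ p := ⟨c ^ (p + 1), (hit (p + 1)).symm⟩
  have hd2 : x * x ^ p * x ^ p * d = x ^ p := by
    rw [← pow_succ', ← pow_add, ← hd]
    congr 2; omega
  have hxc : x ^ p * x = x * x ^ p := (pow_mul_comm' x p)
  have key : ∀ y, x * x ^ p * (x ^ p * y) = 0 → x ^ p * y = 0 := by
    intro y hy
    apply hkk (p + 1)
    rw [← hy, ← mul_assoc, ← pow_succ', ← pow_add]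
    congr 2; omega
  have e0 : x * x ^ p * (x ^ p * (x * d)) = x * x ^ p := by
    calc x * x ^ p * (x ^ p * (x * d)) = x * x ^ p * (x ^ p * x * d) := by
          simp only [mul_assoc]
      _ = x * x ^ p * (x * x ^ p * d) := by rw [hxc]
      _ = x * (x ^ p * x) * x ^ p * d := by simp only [mul_assoc]
      _ = x * (x * x ^ p * x ^ p * d) := by rw [hxc]; simp only [mul_assoc]
      _ = x * x ^ p := by rw [hd2]
  have hcomm : x * (x ^ p * d) = x ^ p * d * x := by
    have h : x ^ p * (x * d - d * x) = 0 := by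
      apply key
      have e2 : x * x ^ p * (x ^ p * (d * x)) = x * x ^ p := by
        calc x * x ^ p * (x ^ p * (d * x)) = (x * x ^ p * x ^ p * d) * x := by
              simp only [mul_assoc]
          _ = x * x ^ p := by rw [hd2, hxc]
      rw [mul_sub, mul_sub, e0, e2, sub_self]
    rw [mul_sub, sub_eq_zero, ← mul_assoc, hxc] at h
    rw [← mul_assoc, h, mul_assoc]
  refine ⟨x ^ p * d, p, ?_, ?_, hcomm⟩
  · rw [mul_assoc, ← hcomm, ← mul_assoc, ← mul_assoc, hxc, hd2]
  · rw [← hcomm]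
    have h : x ^ p * (x * d * (x ^ p * d) - d) = 0 := by
      apply key
      have e1 : x * x ^ p * (x ^ p * (x * d * (x ^ p * d))) = x ^ p := by
        calc x * x ^ p * (x ^ p * (x * d * (x ^ p * d)))
            = x * x ^ p * (x ^ p * (x * d)) * (x ^ p * d) := by simp only [mul_assoc]
          _ = x * x ^ p * x ^ p * d := by rw [e0]; simp only [mul_assoc]
          _ = x ^ p := hd2
      rw [mul_sub, mul_sub, e1, ← mul_assoc, hd2, sub_self]
    rw [mul_sub, sub_eq_zero] at h
    calc x * (x ^ p * d) * (x ^ p * d) = x * x ^ p * d * (x ^ p * d) := by simp only [mul_assoc]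
      _ = x ^ p * (x * d * (x ^ p * d)) := by rw [← hxc]; simp only [mul_assoc]
      _ = x ^ p * d := h

theorem isDrazinInvertible_of_op {R : Type*} [Ring R] {x : R}
    (h : IsDrazinInvertible (MulOpposite.op x)) : IsDrazinInvertible x := by
  obtain ⟨b, m, h1, h2, h3⟩ := h
  have h1' := congrArg MulOpposite.unop h1
  have h2' := congrArg MulOpposite.unop h2
  have h3' := congrArg MulOpposite.unop h3
  simp only [MulOpposite.unop_mul, MulOpposite.unop_pow, MulOpposite.unop_op] at h1' h2' h3'
  refine ⟨b.unop, m, ?_, ?_, h3'.symm⟩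
  · have hx : Commute x b.unop := h3'.symm
    have e : x ^ m * b.unop * x = x * (b.unop * x ^ m) := by
      rw [(hx.pow_left m).eq, ← mul_assoc, hx.eq, mul_assoc, mul_assoc, pow_mul_comm']
    rw [e, h1']
  · rw [mul_assoc, h2']

/-- The mirror image of `isDrazinInvertible_of_pow_eq`, for right multiplication by `x`. -/
theorem isDrazinInvertible_of_pow_eq' {R : Type*} [Ring R] {x c : R} {p : ℕ}
    (hc : x ^ p = c * x ^ (p + 1))
    (hk : ∀ y, y * x ^ (p + 1) = 0 → y * x ^ p = 0) : IsDrazinInvertible x := by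
  apply isDrazinInvertible_of_op
  apply isDrazinInvertible_of_pow_eq (c := MulOpposite.op c) (p := p)
  · rw [← MulOpposite.op_pow, ← MulOpposite.op_pow, ← MulOpposite.op_mul, hc]
  · intro y hy
    have h := hk y.unop (by simpa using congrArg MulOpposite.unop hy)
    exact MulOpposite.unop_injective (by simpa using h)

/-- With `q = x * b`, the idempotent of a Drazin inverse `b` of `x`, the power `x ^ m` and every
higher one is absorbed by `q`. -/
theorem pow_mul_mul_eq {R : Type*} [Ring R] {x b : R} {m : ℕ}
    (h1 : x ^ m * b * x = x ^ m) (h3 : x * b = b * x) {n : ℕ} (hn : m ≤ n) :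
    x ^ n * (x * b) = x ^ n := by
  obtain ⟨k, rfl⟩ := Nat.exists_eq_add_of_le' hn
  rw [pow_add, mul_assoc, h3, ← mul_assoc (x ^ m), h1]

/-- If `b` is a Drazin inverse of `x`, then `x * b = x ^ n * b ^ n` for `n ≥ 1`; the extra factor
`x * b` makes this true for `n = 0` as well. -/
theorem pow_mul_pow_mul_eq {R : Type*} [Ring R] {x b : R}
    (h2 : b * x * b = b) (h3 : x * b = b * x) (n : ℕ) :
    x ^ n * (b ^ n * (x * b)) = x * b := by
  have hq : x * b * (x * b) = x * b := by rw [mul_assoc, ← mul_assoc b, h2]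
  rw [← mul_assoc, ← (show Commute x b from h3).mul_pow]
  induction n with
  | zero => simp
  | succ n ih => rw [pow_succ, mul_assoc, hq, ih]

/-! ### The Drazin spectrum and isolated points of the spectrum -/

/-- If `x` is Drazin invertible, zero is not an accumulation point of its spectrum. -/
theorem IsDrazinInvertible.eventually_isUnit_sub {A : Type*} [NormedRing A] [NormedAlgebra ℂ A]
    [CompleteSpace A] {x : A} (hx : IsDrazinInvertible x) :
    ∀ᶠ μ in 𝓝 (0 : ℂ), μ ≠ 0 → IsUnit (x - algebraMap ℂ A μ) := by
  obtain ⟨b, m, h1, h2, h3⟩ := hx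
  have hu : ∀ᶠ μ in 𝓝 (0 : ℂ), IsUnit (1 - algebraMap ℂ A μ * b) := by
    have hc : Continuous fun μ : ℂ => 1 - algebraMap ℂ A μ * b := by fun_prop
    have := hc.tendsto 0
    refine this.eventually ?_
    rw [map_zero, zero_mul, sub_zero]
    exact Units.nhds 1
  filter_upwards [hu] with μ hμ hμ0
  have hq : x * b * (x * b) = x * b := by rw [mul_assoc, ← mul_assoc b, h2]
  set t := algebraMap ℂ A μ with ht
  set s := algebraMap ℂ A μ⁻¹ with hs
  have hts : t * s = 1 := by rw [ht, hs, ← map_mul, mul_inv_cancel₀ hμ0, map_one]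
  have htc : ∀ y, t * y = y * t := fun y => Algebra.commutes μ y
  have hsc : ∀ y, s * y = y * s := fun y => Algebra.commutes μ⁻¹ y
  set q := x * b with hqdef
  have hqx : q * x = x * q := by rw [hqdef, mul_assoc, ← h3]
  have hqb : q * b = b * q := by rw [hqdef, ← mul_assoc, ← h3]
  have hbq : b * q = b := by rw [hqdef, ← mul_assoc, h2]
  have hqcompl : (1 - q) * (1 - q) = 1 - q := by
    rw [mul_sub, sub_mul, sub_mul, hq]; simp
  -- The unit on the two complementary corners: `1` on the range of `q`, `-μ` on its kernel.
  have hv : IsUnit (q - t * (1 - q)) := by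
    have hq0 : q * (1 - q) = 0 := by rw [mul_sub, hq, mul_one, sub_self]
    have hq1 : (1 - q) * q = 0 := by rw [sub_mul, hq, one_mul, sub_self]
    have hst : s * t = 1 := by rw [← htc, hts]
    refine ⟨⟨q - t * (1 - q), q - s * (1 - q), ?_, ?_⟩, rfl⟩
    · calc (q - t * (1 - q)) * (q - s * (1 - q))
          = q * q - q * s * (1 - q) - t * ((1 - q) * q) + t * ((1 - q) * s) * (1 - q) := by
            noncomm_ring
        _ = q * q - s * (q * (1 - q)) - t * ((1 - q) * q) + (t * s) * ((1 - q) * (1 - q)) := by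
            rw [← hsc q, ← hsc (1 - q)]; noncomm_ring
        _ = 1 := by rw [hq, hq0, hq1, hqcompl, hts]; noncomm_ring
    · calc (q - s * (1 - q)) * (q - t * (1 - q))
          = q * q - q * t * (1 - q) - s * ((1 - q) * q) + s * ((1 - q) * t) * (1 - q) := by
            noncomm_ring
        _ = q * q - t * (q * (1 - q)) - s * ((1 - q) * q) + (s * t) * ((1 - q) * (1 - q)) := by
            rw [← htc q, ← htc (1 - q)]; noncomm_ring
        _ = 1 := by rw [hq, hq0, hq1, hqcompl, hst]; noncomm_ring
  have hcxb : Commute x b := h3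
  have hcxt : Commute x t := (htc x).symm
  have hcbt : Commute b t := (htc b).symm
  have hcxq : Commute x q := hqx.symm
  have hcbq : Commute b q := hqb.symm
  have hctq : Commute t q := htc q
  have hxq : Commute x (1 - q) := (Commute.one_right x).sub_right hcxq
  have hnil : IsNilpotent (x * (1 - q)) := by
    refine ⟨m + 1, ?_⟩
    rw [hxq.mul_pow, pow_succ (1 - q)]
    have : x ^ (m + 1) * (1 - q) = 0 := by
      rw [mul_sub, mul_one, pow_mul_mul_eq h1 h3 (Nat.le_succ m), sub_self]
    have hc : Commute ((1 - q) ^ m) (1 - q) := (Commute.refl _).pow_left m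
    rw [hc.eq, ← mul_assoc, this, zero_mul]
  have hident : (x - t) * (b + (1 - q)) = (1 - t * b) * (q - t * (1 - q)) + x * (1 - q) := by
    have e : t * b * (q - t * (1 - q)) = t * b := by
      have e' : b * (1 - q) = 0 := by rw [mul_sub, hbq, mul_one, sub_self]
      calc t * b * (q - t * (1 - q)) = t * (b * q) - t * (b * t) * (1 - q) := by noncomm_ring
        _ = t * (b * q) - t * t * (b * (1 - q)) := by rw [← htc b]; noncomm_ring
        _ = t * b := by rw [e', hbq]; simp
    rw [sub_mul 1, e, mul_add, sub_mul, ← hqdef]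
    noncomm_ring
  have hunit : IsUnit ((x - t) * (b + (1 - q))) := by
    rw [hident, add_comm]
    refine hnil.isUnit_add_right_of_commute (hμ.mul hv) ?_
    have c1 : Commute (x * (1 - q)) t := hcxt.mul_left ((Commute.one_left t).sub_left hctq.symm)
    have c2 : Commute (x * (1 - q)) b := hcxb.mul_left ((Commute.one_left b).sub_left hcbq.symm)
    have c3 : Commute (x * (1 - q)) q :=
      hcxq.mul_left ((Commute.one_left q).sub_left (Commute.refl q))
    exact ((Commute.one_right _).sub_right (c1.mul_right c2)).mul_right
      (c3.sub_right (c1.mul_right ((Commute.one_right _).sub_right c3)))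
  have hcomm : Commute (x - t) (b + (1 - q)) :=
    (hcxb.add_right hxq).sub_left
      (hcbt.symm.add_right ((Commute.one_right t).sub_right hctq))
  exact (hcomm.isUnit_mul_iff.1 hunit).1

theorem drazinSpectrum_subset_spectrum {A : Type*} [Ring A] [Algebra ℂ A] (a : A) :
    drazinSpectrum a ⊆ spectrum ℂ a := by
  intro z hz hu
  apply hz
  have hu : IsUnit (algebraMap ℂ A z - a) := hu
  rw [← IsUnit.neg_iff, neg_sub] at hu
  obtain ⟨u, hu⟩ := hu
  rw [← hu]
  exact ⟨↑u⁻¹, 0, by simp, by simp, by simp⟩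

theorem countable_spectrum_diff_drazinSpectrum {A : Type*} [NormedRing A] [NormedAlgebra ℂ A]
    [CompleteSpace A] (a : A) : (spectrum ℂ a \ drazinSpectrum a).Countable := by
  set D := spectrum ℂ a \ drazinSpectrum a
  have hD : DiscreteTopology D := by
    rw [discreteTopology_subtype_iff]
    intro z hz
    have hdr : IsDrazinInvertible (a - algebraMap ℂ A z) := not_not.1 hz.2
    have h := hdr.eventually_isUnit_sub
    have ht : Tendsto (fun w : ℂ => w - z) (𝓝 z) (𝓝 0) := by
      have : Continuous fun w : ℂ => w - z := by fun_prop
      simpa using this.tendsto z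
    have h' := ht.eventually h
    rw [← disjoint_iff, disjoint_principal_right]
    rw [mem_nhdsWithin_iff_eventually]
    filter_upwards [h'] with w hw hwz hwD
    have hu := hw (sub_ne_zero.2 hwz)
    rw [map_sub, sub_sub_sub_cancel_right, ← IsUnit.neg_iff, neg_sub] at hu
    exact hwD.1 hu
  exact (Set.countable_coe_iff).1 (TopologicalSpace.separableSpace_iff_countable.1 inferInstance)

/-! ### Ascent and descent -/

theorem exists_iInf_eq_of_lt_top {P : ℕ → Prop}
    (h : (⨅ (n : ℕ) (_ : P n), (n : ℕ∞)) < ⊤) :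
    ∃ n : ℕ, P n ∧ (⨅ (n : ℕ) (_ : P n), (n : ℕ∞)) = n := by
  classical
  have hex : ∃ n, P n := by
    by_contra! hn
    simp [hn] at h
  refine ⟨Nat.find hex, Nat.find_spec hex, le_antisymm ?_ ?_⟩
  · exact iInf₂_le _ (Nat.find_spec hex)
  · exact le_iInf₂ fun n hn => by exact_mod_cast Nat.find_min' hex hn

section Operators

variable {X : Type*} [NormedAddCommGroup X] [NormedSpace ℂ X]

theorem exists_opAscent_eq {T : X →L[ℂ] X} (h : opAscent T < ⊤) :
    ∃ p : ℕ, {x : X | (T ^ p) x = 0} = {x : X | (T ^ (p + 1)) x = 0} ∧ opAscent T = p :=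
  exists_iInf_eq_of_lt_top h

theorem exists_opDescent_eq {T : X →L[ℂ] X} (h : opDescent T < ⊤) :
    ∃ q : ℕ, Set.range ⇑(T ^ q) = Set.range ⇑(T ^ (q + 1)) ∧ opDescent T = q :=
  exists_iInf_eq_of_lt_top h

theorem opAscent_lt_top {T : X →L[ℂ] X} {n : ℕ}
    (h : {x : X | (T ^ n) x = 0} = {x : X | (T ^ (n + 1)) x = 0}) : opAscent T < ⊤ :=
  (iInf₂_le n h).trans_lt (ENat.natCast_lt_top n)

theorem opDescent_lt_top {T : X →L[ℂ] X} {n : ℕ}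
    (h : Set.range ⇑(T ^ n) = Set.range ⇑(T ^ (n + 1))) : opDescent T < ⊤ :=
  (iInf₂_le n h).trans_lt (ENat.natCast_lt_top n)

theorem pow_succ_apply_comm (T : X →L[ℂ] X) (n : ℕ) (x : X) : (T ^ (n + 1)) x = T ((T ^ n) x) := by
  rw [pow_succ']; rfl

theorem pow_succ_apply (T : X →L[ℂ] X) (n : ℕ) (x : X) : (T ^ (n + 1)) x = (T ^ n) (T x) := by
  rw [pow_succ]; rfl

theorem pow_apply_eq_zero_of_le {T : X →L[ℂ] X} {p : ℕ}
    (h : {x : X | (T ^ p) x = 0} = {x : X | (T ^ (p + 1)) x = 0}) (k : ℕ) {x : X}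
    (hx : (T ^ (p + k)) x = 0) : (T ^ p) x = 0 := by
  induction k generalizing x with
  | zero => exact hx
  | succ k ih =>
    have h1 : (T ^ p) (T x) = 0 := ih (by rw [← hx, ← add_assoc, pow_succ_apply])
    rw [← pow_succ_apply] at h1
    exact (Set.ext_iff.1 h x).2 h1

theorem range_pow_eq_of_le {T : X →L[ℂ] X} {q : ℕ}
    (h : Set.range ⇑(T ^ q) = Set.range ⇑(T ^ (q + 1))) (k : ℕ) :
    Set.range ⇑(T ^ (q + k)) = Set.range ⇑(T ^ q) := by
  induction k with
  | zero => rfl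
  | succ k ih =>
    have e : ∀ n, Set.range ⇑(T ^ (n + 1)) = T '' Set.range ⇑(T ^ n) := by
      intro n
      rw [← Set.range_comp]
      exact congrArg Set.range (funext fun x => pow_succ_apply_comm T n x)
    rw [← add_assoc, e, ih, ← e, ← h]

/-- The range of a bounded idempotent is closed, being the kernel of the complementary one. -/
theorem isClosed_range_of_idempotent {Q : X →L[ℂ] X} (hQ : Q * Q = Q) :
    IsClosed (Set.range ⇑Q) := by
  have : Set.range ⇑Q = {x | Q x = x} := by
    ext x
    constructor
    · rintro ⟨y, rfl⟩
      exact DFunLike.congr_fun hQ y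
    · exact fun h => ⟨x, h⟩
  rw [this]
  exact isClosed_eq Q.continuous continuous_id

theorem range_pow_eq_range_mul {T B : X →L[ℂ] X} (h2 : B * T * B = B) (h3 : T * B = B * T) {n : ℕ}
    (hn : T ^ n * (T * B) = T ^ n) : Set.range ⇑(T ^ n) = Set.range ⇑(T * B) := by
  apply Set.Subset.antisymm
  · rintro _ ⟨x, rfl⟩
    have hc : T ^ n * (T * B) = T * B * T ^ n :=
      ((Commute.refl T).mul_right (show Commute T B from h3)).pow_left n
    refine ⟨(T ^ n) x, ?_⟩
    rw [hc] at hn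
    exact DFunLike.congr_fun hn x
  · rintro _ ⟨x, rfl⟩
    exact ⟨(B ^ n * (T * B)) x, DFunLike.congr_fun (pow_mul_pow_mul_eq h2 h3 n) x⟩

theorem IsDrazinInvertible.isRightDrazin {T : X →L[ℂ] X} (hT : IsDrazinInvertible T) :
    IsRightDrazin T := by
  obtain ⟨B, m, h1, h2, h3⟩ := hT
  have hr : ∀ n, m ≤ n → Set.range ⇑(T ^ n) = Set.range ⇑(T * B) := fun n hn =>
    range_pow_eq_range_mul h2 h3 (pow_mul_mul_eq h1 h3 hn)
  obtain ⟨q, hq, hq'⟩ := exists_opDescent_eq (T := T) (opDescent_lt_top (n := m)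
    ((hr m le_rfl).trans (hr (m + 1) (Nat.le_succ m)).symm))
  refine ⟨q, hq', ?_⟩
  rw [← range_pow_eq_of_le hq m, hr _ (Nat.le_add_left m q)]
  exact isClosed_range_of_idempotent (by rw [mul_assoc, ← mul_assoc B, h2])

theorem IsDrazinInvertible.isLeftDrazin {T : X →L[ℂ] X} (hT : IsDrazinInvertible T) :
    IsLeftDrazin T := by
  obtain ⟨B, m, h1, h2, h3⟩ := hT
  have hker : {x : X | (T ^ m) x = 0} = {x : X | (T ^ (m + 1)) x = 0} := by
    ext x
    constructor
    · intro hx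
      have hx : (T ^ m) x = 0 := hx
      rw [Set.mem_ofPred_eq, pow_succ_apply_comm, hx, map_zero]
    · intro hx
      have hx : (T ^ (m + 1)) x = 0 := hx
      have e : T ^ m = B * T ^ (m + 1) := by
        have hc : Commute (T ^ m) (B * T) :=
          ((show Commute T B from h3).mul_right (Commute.refl T)).pow_left m
        rw [pow_succ', ← mul_assoc, ← hc.eq, ← mul_assoc, h1]
      rw [Set.mem_ofPred_eq, e]
      change B ((T ^ (m + 1)) x) = 0
      rw [hx, map_zero]
  obtain ⟨p, hp, hp'⟩ := exists_opAscent_eq (opAscent_lt_top hker)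
  refine ⟨p, hp', ?_⟩
  -- Even if `p < m`, the operator `1 - T * B` maps into `N(T ^ (p + m)) = N(T ^ p)`.
  have hpq : T ^ p * (T * B) = T ^ p := by
    ext x
    have hz : (T ^ (p + m)) (x - (T * B) x) = 0 := by
      rw [map_sub, sub_eq_zero]
      exact (DFunLike.congr_fun (pow_mul_mul_eq h1 h3 (Nat.le_add_left m p)) x).symm
    have := pow_apply_eq_zero_of_le hp m hz
    rw [map_sub, sub_eq_zero] at this
    exact this.symm
  have hpq' : T ^ (p + 1) * (T * B) = T ^ (p + 1) := by rw [pow_succ', mul_assoc, hpq]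
  rw [range_pow_eq_range_mul h2 h3 hpq']
  exact isClosed_range_of_idempotent (by rw [mul_assoc, ← mul_assoc B, h2])

/-! ### Operators that are limits of invertible translates -/

/-- A left Drazin invertible operator that is a limit of invertible operators `S - μ` has finite descent
too. The open mapping theorem for `S ^ (p + 1)`, whose range is closed, bounds `S` below on `R(S ^ p)`,
so that `(S - μ)⁻¹ y` stays bounded as `μ → 0` for `y` in `R(S ^ p)`. -/
theorem exists_range_ker_eq_of_isLeftDrazin [CompleteSpace X] {S : X →L[ℂ] X}
    (hS : ∃ᶠ μ in 𝓝 (0 : ℂ), IsUnit (S - algebraMap ℂ (X →L[ℂ] X) μ)) (h : IsLeftDrazin S) :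
    ∃ p : ℕ, Set.range ⇑(S ^ p) = Set.range ⇑(S ^ (p + 1)) ∧
      {x : X | (S ^ p) x = 0} = {x : X | (S ^ (p + 1)) x = 0} := by
  obtain ⟨p, hp, hcl⟩ := h
  obtain ⟨p', hk, hp'⟩ := exists_opAscent_eq (T := S) (by rw [hp]; exact ENat.natCast_lt_top p)
  obtain rfl : p = p' := by exact_mod_cast hp.symm.trans hp'
  refine ⟨p, Set.Subset.antisymm ?_ ?_, hk⟩
  swap
  · rintro _ ⟨x, rfl⟩
    exact ⟨S x, (pow_succ_apply S p x).symm⟩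
  obtain ⟨C, hC, hpre⟩ : ∃ C > 0, ∀ x, ∃ v, (S ^ (p + 1)) v = (S ^ (p + 1)) x ∧
      ‖v‖ ≤ C * ‖(S ^ (p + 1)) x‖ := by
    have hcl' : IsClosed ((S ^ (p + 1)).range : Set X) := by
      simpa only [LinearMap.coe_range, ContinuousLinearMap.coe_coe] using hcl
    have := hcl'.completeSpace_coe
    obtain ⟨C, hC, h⟩ := (S ^ (p + 1)).rangeRestrict.exists_preimage_norm_le (by
      rintro ⟨_, x, rfl⟩
      exact ⟨x, rfl⟩)
    refine ⟨C, hC, fun x => ?_⟩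
    obtain ⟨v, hv, hv'⟩ := h ⟨(S ^ (p + 1)) x, x, rfl⟩
    exact ⟨v, congrArg Subtype.val hv, hv'⟩
  obtain ⟨K, hK, hbelow⟩ : ∃ K > 0, ∀ u, ‖(S ^ p) u‖ ≤ K * ‖S ((S ^ p) u)‖ := by
    refine ⟨(‖S ^ p‖ + 1) * C, by positivity, fun u => ?_⟩
    obtain ⟨v, hv, hv'⟩ := hpre u
    have h0 : (S ^ (p + 1)) (u - v) = 0 := by rw [map_sub, hv, sub_self]
    have h1 : (S ^ p) (u - v) = 0 := (Set.ext_iff.1 hk _).2 h0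
    rw [map_sub, sub_eq_zero] at h1
    rw [pow_succ_apply_comm] at hv'
    rw [h1, mul_assoc, ← h1]
    calc ‖(S ^ p) u‖ = ‖(S ^ p) v‖ := by rw [h1]
      _ ≤ ‖S ^ p‖ * ‖v‖ := (S ^ p).le_opNorm v
      _ ≤ (‖S ^ p‖ + 1) * (C * ‖S ((S ^ p) u)‖) := by gcongr; linarith
  rintro y ⟨w, rfl⟩
  rw [← hcl.closure_eq, Metric.mem_closure_iff]
  intro ε hε
  set M := 2 * K * ‖(S ^ p) w‖ with hM
  have hM0 : 0 ≤ M := by positivity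
  have hsmall : ∀ᶠ μ in 𝓝 (0 : ℂ), ‖μ‖ < min (1 / (2 * K)) (ε / (M + 1)) := by
    have hpos : 0 < min (1 / (2 * K)) (ε / (M + 1)) := by positivity
    filter_upwards [Metric.ball_mem_nhds (0 : ℂ) hpos] with μ hμ
    exact mem_ball_zero_iff.1 hμ
  obtain ⟨μ, hu, hμ⟩ := (hS.and_eventually hsmall).exists
  obtain ⟨u, hu⟩ := hu
  have hμ1 : ‖μ‖ * (2 * K) < 1 := (lt_div_iff₀ (by positivity)).1 (hμ.trans_le (min_le_left _ _))
  have hμ2 : ‖μ‖ * (M + 1) < ε := (lt_div_iff₀ (by positivity)).1 (hμ.trans_le (min_le_right _ _))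
  set G : X →L[ℂ] X := ↑u⁻¹ with hG
  have hSG : ∀ x, S (G x) - μ • G x = x := by
    intro x
    have : (S - algebraMap ℂ (X →L[ℂ] X) μ) * G = 1 := by rw [← hu, hG]; simp
    have := DFunLike.congr_fun this x
    simpa [Algebra.algebraMap_eq_smul_one] using this
  have hcomm : Commute S G := by
    have hc : Commute S (u : X →L[ℂ] X) := by
      rw [hu]
      exact (Commute.refl S).sub_right (Algebra.commutes μ S).symm
    exact hc.units_inv_right
  have hz : G ((S ^ p) w) = (S ^ p) (G w) := by
    exact (DFunLike.congr_fun (hcomm.pow_left p).eq w).symm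
  set z := (S ^ p) (G w) with hzdef
  have hzy : S z - μ • z = (S ^ p) w := by rw [← hz]; exact hSG _
  have hb : ‖z‖ ≤ M := by
    have h1 : ‖z‖ ≤ K * ‖S z‖ := hbelow (G w)
    have h2 : ‖S z‖ ≤ ‖(S ^ p) w‖ + ‖μ‖ * ‖z‖ := by
      rw [← norm_smul]
      calc ‖S z‖ = ‖(S ^ p) w + μ • z‖ := by rw [← hzy]; simp
        _ ≤ _ := norm_add_le _ _
    have h3 : K * ‖S z‖ ≤ K * (‖(S ^ p) w‖ + ‖μ‖ * ‖z‖) := by gcongr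
    have h4 : ‖μ‖ * (2 * K) * ‖z‖ ≤ 1 * ‖z‖ := by gcongr
    rw [hM]
    nlinarith
  refine ⟨S z, ⟨G w, pow_succ_apply_comm S p (G w)⟩, ?_⟩
  rw [dist_comm, dist_eq_norm]
  have : S z - (S ^ p) w = μ • z := by rw [← hzy]; simp
  rw [this, norm_smul]
  calc ‖μ‖ * ‖z‖ ≤ ‖μ‖ * (M + 1) := by gcongr; linarith
    _ < ε := hμ2

/-- If `R(S ^ d) = R(S ^ (d + 1))` and `S` is a limit of invertible operators `S - μ`, then
`N(S ^ (d + 1)) ⊆ N(S ^ d)`: a vector `u` of the former starts a power series `v(μ)` with values in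
`N(S ^ d * (S - μ))`. No closedness of `R(S ^ d)` is needed. -/
theorem pow_apply_eq_zero_of_range_eq [CompleteSpace X] {S : X →L[ℂ] X} {d : ℕ}
    (hS : ∃ᶠ μ in 𝓝 (0 : ℂ), IsUnit (S - algebraMap ℂ (X →L[ℂ] X) μ))
    (hd : Set.range ⇑(S ^ d) = Set.range ⇑(S ^ (d + 1))) {u : X} (hu : (S ^ (d + 1)) u = 0) :
    (S ^ d) u = 0 := by
  -- Open mapping theorem for `X × N(S ^ d) → X`, `(y, n) ↦ S y + n`.
  obtain ⟨C, hC, hpre⟩ : ∃ C > 0, ∀ x, ∃ y, (S ^ (d + 1)) y = (S ^ d) x ∧ ‖y‖ ≤ C * ‖x‖ := by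
    set N : Submodule ℂ X := (S ^ d).ker
    have : CompleteSpace N := (S ^ d).isClosed_ker.completeSpace_coe
    obtain ⟨C, hC, h⟩ := (S.coprod N.subtypeL).exists_preimage_norm_le (by
      intro x
      obtain ⟨y, hy⟩ : (S ^ d) x ∈ Set.range ⇑(S ^ (d + 1)) := hd ▸ ⟨x, rfl⟩
      refine ⟨(y, ⟨x - S y, ?_⟩), ?_⟩
      · change (S ^ d) (x - S y) = 0
        rw [map_sub, ← pow_succ_apply, hy, sub_self]
      · simp)
    refine ⟨C, hC, fun x => ?_⟩
    obtain ⟨⟨y, n⟩, hyn, hle⟩ := h x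
    refine ⟨y, ?_, (norm_fst_le (y, n)).trans hle⟩
    have hn : (S ^ d) (n : X) = 0 := n.2
    have hx : x = S y + n := hyn.symm
    rw [hx, map_add, hn, add_zero, pow_succ_apply]
  choose f hf hfn using hpre
  set s : ℕ → X := fun k => f^[k] u with hs
  have hs0 : s 0 = u := rfl
  have hsucc : ∀ k, s (k + 1) = f (s k) := fun k => Function.iterate_succ_apply' f k u
  have hsn : ∀ k, ‖s k‖ ≤ C ^ k * ‖u‖ := by
    intro k
    induction k with
    | zero => simp [hs0]
    | succ k ih =>
      rw [hsucc, pow_succ', mul_assoc]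
      exact (hfn _).trans (by gcongr)
  set r : ℝ := 1 / (2 * C) with hr
  have hr0 : 0 < r := by positivity
  have hbound : ∀ k, ∀ μ ∈ Metric.closedBall (0 : ℂ) r, ‖μ ^ k • s k‖ ≤ (1 / 2 : ℝ) ^ k * ‖u‖ := by
    intro k μ hμ
    have hμ' : ‖μ‖ ≤ r := by simpa using hμ
    have hrC : r * C = 1 / 2 := by rw [hr]; field_simp
    rw [norm_smul, norm_pow]
    calc ‖μ‖ ^ k * ‖s k‖ ≤ r ^ k * (C ^ k * ‖u‖) := by gcongr; exact hsn k
      _ = (1 / 2 : ℝ) ^ k * ‖u‖ := by rw [← mul_assoc, ← mul_pow, hrC]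
  have hsumb : Summable fun k : ℕ => (1 / 2 : ℝ) ^ k * ‖u‖ :=
    (summable_geometric_of_lt_one (by norm_num) (by norm_num)).mul_right _
  set v : ℂ → X := fun μ => ∑' k, μ ^ k • s k with hv
  have hvc : ContinuousAt v 0 := by
    have : ContinuousOn v (Metric.closedBall (0 : ℂ) r) :=
      continuousOn_tsum (fun k => by fun_prop) hsumb hbound
    exact this.continuousAt (Metric.closedBall_mem_nhds 0 hr0)
  have hv0 : v 0 = u := by
    rw [hv]
    change ∑' k, (0 : ℂ) ^ k • s k = u
    rw [tsum_eq_single 0 (fun k hk => by simp [hk])]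
    simp [hs0]
  have hker : ∀ μ ∈ Metric.closedBall (0 : ℂ) r, (S ^ (d + 1)) (v μ) = μ • (S ^ d) (v μ) := by
    intro μ hμ
    have hsm : Summable fun k => μ ^ k • s k :=
      Summable.of_norm_bounded hsumb fun k => hbound k μ hμ
    rw [hv]
    change (S ^ (d + 1)) (∑' k, μ ^ k • s k) = μ • (S ^ d) (∑' k, μ ^ k • s k)
    rw [(S ^ (d + 1)).map_tsum hsm, (S ^ d).map_tsum hsm,
      ((S ^ (d + 1)).summable hsm).tsum_eq_zero_add,
      ← ((S ^ d).summable hsm).tsum_const_smul]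
    simp only [map_smul, hsucc, hf, hs0, hu, smul_zero, zero_add, pow_succ' μ, mul_smul]
  have hfreq : ∃ᶠ μ in 𝓝 (0 : ℂ), (S ^ d) (v μ) = 0 := by
    refine (hS.and_eventually (Metric.closedBall_mem_nhds 0 hr0)).mono ?_
    rintro μ ⟨⟨w, hw⟩, hμ⟩
    have h0 : (w : X →L[ℂ] X) ((S ^ d) (v μ)) = 0 := by
      rw [hw, Algebra.algebraMap_eq_smul_one]
      change S ((S ^ d) (v μ)) - μ • (S ^ d) (v μ) = 0
      rw [← pow_succ_apply_comm, hker μ hμ, sub_self]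
    have h1 : ((↑w⁻¹ : X →L[ℂ] X) * (w : X →L[ℂ] X)) ((S ^ d) (v μ)) = 0 := by
      change (↑w⁻¹ : X →L[ℂ] X) ((w : X →L[ℂ] X) ((S ^ d) (v μ))) = 0
      rw [h0, map_zero]
    simpa using h1
  have hcont : ContinuousAt (fun μ => (S ^ d) (v μ)) 0 := (S ^ d).continuous.continuousAt.comp hvc
  by_contra hne
  have hev : ∀ᶠ μ in 𝓝 (0 : ℂ), (S ^ d) (v μ) ≠ 0 := hcont.eventually_ne (by rwa [hv0])
  exact hfreq (hev.mono fun μ h => h)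

theorem exists_range_ker_eq_of_opDescent_lt_top [CompleteSpace X] {S : X →L[ℂ] X}
    (hS : ∃ᶠ μ in 𝓝 (0 : ℂ), IsUnit (S - algebraMap ℂ (X →L[ℂ] X) μ)) (h : opDescent S < ⊤) :
    ∃ p : ℕ, Set.range ⇑(S ^ p) = Set.range ⇑(S ^ (p + 1)) ∧
      {x : X | (S ^ p) x = 0} = {x : X | (S ^ (p + 1)) x = 0} := by
  obtain ⟨d, hd, -⟩ := exists_opDescent_eq h
  refine ⟨d, hd, Set.Subset.antisymm (fun x hx => ?_) fun x hx =>
    pow_apply_eq_zero_of_range_eq hS hd hx⟩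
  have hx : (S ^ d) x = 0 := hx
  rw [Set.mem_ofPred_eq, pow_succ_apply_comm, hx, map_zero]

theorem IsRightDrazin.opDescent_lt_top {T : X →L[ℂ] X} (h : IsRightDrazin T) : opDescent T < ⊤ := by
  obtain ⟨q, hq, -⟩ := h
  rw [hq]
  exact ENat.natCast_lt_top q

end Operators

/-! ### Multiplication operators -/

section Multiplication

variable {A : Type*} [NormedRing A] [NormedAlgebra ℂ A]

@[simp] theorem leftMulOp_apply (a x : A) : leftMulOp a x = a * x := rfl

@[simp] theorem rightMulOp_apply (a x : A) : rightMulOp a x = x * a := rfl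

theorem leftMulOp_mul (a b : A) : leftMulOp (a * b) = leftMulOp a * leftMulOp b := by
  ext x; simp [mul_assoc]

theorem rightMulOp_mul (a b : A) : rightMulOp (a * b) = rightMulOp b * rightMulOp a := by
  ext x; simp [mul_assoc]

theorem leftMulOp_one : leftMulOp (1 : A) = 1 := by ext x; simp

theorem rightMulOp_one : rightMulOp (1 : A) = 1 := by ext x; simp

theorem leftMulOp_pow (a : A) (n : ℕ) : leftMulOp (a ^ n) = leftMulOp a ^ n := by
  induction n with
  | zero => simp [leftMulOp_one]
  | succ n ih => rw [pow_succ, leftMulOp_mul, ih, pow_succ]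

theorem rightMulOp_pow (a : A) (n : ℕ) : rightMulOp (a ^ n) = rightMulOp a ^ n := by
  induction n with
  | zero => simp [rightMulOp_one]
  | succ n ih => rw [pow_succ', rightMulOp_mul, ih, pow_succ]

theorem leftMulOp_sub_algebraMap (a : A) (z : ℂ) :
    leftMulOp (a - algebraMap ℂ A z) = leftMulOp a - algebraMap ℂ (A →L[ℂ] A) z := by
  ext x; simp [sub_mul, Algebra.algebraMap_eq_smul_one]

theorem rightMulOp_sub_algebraMap (a : A) (z : ℂ) :
    rightMulOp (a - algebraMap ℂ A z) = rightMulOp a - algebraMap ℂ (A →L[ℂ] A) z := by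
  ext x; simp [mul_sub, Algebra.algebraMap_eq_smul_one]

theorem isUnit_leftMulOp {a : A} (h : IsUnit a) : IsUnit (leftMulOp a) := by
  obtain ⟨u, rfl⟩ := h
  exact ⟨⟨leftMulOp u, leftMulOp ↑u⁻¹, by rw [← leftMulOp_mul, u.mul_inv, leftMulOp_one],
    by rw [← leftMulOp_mul, u.inv_mul, leftMulOp_one]⟩, rfl⟩

theorem isUnit_rightMulOp {a : A} (h : IsUnit a) : IsUnit (rightMulOp a) := by
  obtain ⟨u, rfl⟩ := h
  exact ⟨⟨rightMulOp u, rightMulOp ↑u⁻¹, by rw [← rightMulOp_mul, u.inv_mul, rightMulOp_one],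
    by rw [← rightMulOp_mul, u.mul_inv, rightMulOp_one]⟩, rfl⟩

theorem IsDrazinInvertible.leftMulOp {x : A} (h : IsDrazinInvertible x) :
    IsDrazinInvertible (leftMulOp x) := by
  obtain ⟨b, m, h1, h2, h3⟩ := h
  refine ⟨_root_.leftMulOp b, m, ?_, ?_, ?_⟩
  · rw [← leftMulOp_pow, ← leftMulOp_mul, ← leftMulOp_mul, h1]
  · rw [← leftMulOp_mul, ← leftMulOp_mul, h2]
  · rw [← leftMulOp_mul, ← leftMulOp_mul, h3]

theorem IsDrazinInvertible.rightMulOp {x : A} (h : IsDrazinInvertible x) :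
    IsDrazinInvertible (rightMulOp x) := by
  obtain ⟨b, m, h1, h2, h3⟩ := h
  refine ⟨_root_.rightMulOp b, m, ?_, ?_, ?_⟩
  · have hx : Commute x b := h3
    have e : x * (b * x ^ m) = x ^ m * b * x := by
      rw [(hx.pow_left m).eq, ← mul_assoc, hx.eq, mul_assoc, mul_assoc, pow_mul_comm']
    rw [← rightMulOp_pow, ← rightMulOp_mul, ← rightMulOp_mul, e, h1]
  · rw [← rightMulOp_mul, ← rightMulOp_mul, ← mul_assoc, h2]
  · rw [← rightMulOp_mul, ← rightMulOp_mul, h3]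

theorem isDrazinInvertible_of_leftMulOp {x : A}
    (h : ∃ p : ℕ, Set.range ⇑(leftMulOp x ^ p) = Set.range ⇑(leftMulOp x ^ (p + 1)) ∧
      {y : A | (leftMulOp x ^ p) y = 0} = {y : A | (leftMulOp x ^ (p + 1)) y = 0}) :
    IsDrazinInvertible x := by
  obtain ⟨p, hr, hk⟩ := h
  simp only [← leftMulOp_pow] at hr hk
  obtain ⟨c, hc⟩ : x ^ p ∈ Set.range ⇑(leftMulOp (x ^ (p + 1))) := hr ▸ ⟨1, mul_one _⟩
  exact isDrazinInvertible_of_pow_eq hc.symm fun y hy => (Set.ext_iff.1 hk y).2 hy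

theorem isDrazinInvertible_of_rightMulOp {x : A}
    (h : ∃ p : ℕ, Set.range ⇑(rightMulOp x ^ p) = Set.range ⇑(rightMulOp x ^ (p + 1)) ∧
      {y : A | (rightMulOp x ^ p) y = 0} = {y : A | (rightMulOp x ^ (p + 1)) y = 0}) :
    IsDrazinInvertible x := by
  obtain ⟨p, hr, hk⟩ := h
  simp only [← rightMulOp_pow] at hr hk
  obtain ⟨c, hc⟩ : x ^ p ∈ Set.range ⇑(rightMulOp (x ^ (p + 1))) := hr ▸ ⟨1, one_mul _⟩
  exact isDrazinInvertible_of_pow_eq' hc.symm fun y hy => (Set.ext_iff.1 hk y).2 hy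

/-- The complement of a countable spectrum is dense, so every translate of `a` is a limit of
invertible ones. -/
theorem frequently_isUnit_sub {a : A} (h : (spectrum ℂ a).Countable) (z : ℂ) :
    ∃ᶠ μ in 𝓝 (0 : ℂ), IsUnit (a - algebraMap ℂ A z - algebraMap ℂ A μ) := by
  have hz : ∃ᶠ w in 𝓝 z, w ∈ (spectrum ℂ a)ᶜ :=
    mem_closure_iff_frequently.1 (h.dense_compl ℂ z)
  have ht : Tendsto (fun w : ℂ => w - z) (𝓝 z) (𝓝 0) := by
    have : Continuous fun w : ℂ => w - z := by fun_prop
    simpa using this.tendsto z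
  refine ht.frequently (hz.mono fun w hw => ?_)
  have hu : IsUnit (algebraMap ℂ A w - a) := not_not.1 hw
  rwa [map_sub, sub_sub_sub_cancel_right, ← IsUnit.neg_iff, neg_sub]

end Multiplication

theorem derivedSpectrum_eq_derivedSpectrum {A B : Type*} [Ring A] [Algebra ℂ A] [Ring B]
    [Algebra ℂ B] {R : Set A} {R' : Set B} {a : A} {b : B}
    (h : ∀ z, a - algebraMap ℂ A z ∈ R ↔ b - algebraMap ℂ B z ∈ R') :
    derivedSpectrum R a = derivedSpectrum R' b :=
  Set.ext fun z => not_congr (h z)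

theorem theorem2p2 {A : Type*} [NormedRing A] [NormedAlgebra ℂ A] [CompleteSpace A] (a : A) :
    ((spectrum ℂ a).Countable ↔ (drazinSpectrum a).Countable) ∧
    ((spectrum ℂ a).Countable →
      drazinSpectrum a = leftDrazinSpectrum (leftMulOp a) ∧
      drazinSpectrum a = rightDrazinSpectrum (leftMulOp a) ∧
      drazinSpectrum a = descentSpectrum (leftMulOp a) ∧
      drazinSpectrum a = leftDrazinSpectrum (rightMulOp a) ∧
      drazinSpectrum a = rightDrazinSpectrum (rightMulOp a) ∧
      drazinSpectrum a = descentSpectrum (rightMulOp a)) := by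
  refine ⟨⟨fun h => h.mono (drazinSpectrum_subset_spectrum a), fun h => ?_⟩, fun h => ?_⟩
  · exact (h.union (countable_spectrum_diff_drazinSpectrum a)).mono fun z hz =>
      (em (z ∈ drazinSpectrum a)).imp id fun hn => ⟨hz, hn⟩
  have hL : ∀ z, ∃ᶠ μ in 𝓝 (0 : ℂ),
      IsUnit (leftMulOp (a - algebraMap ℂ A z) - algebraMap ℂ (A →L[ℂ] A) μ) := fun z =>
    (frequently_isUnit_sub h z).mono fun μ hμ => by
      rw [← leftMulOp_sub_algebraMap]; exact isUnit_leftMulOp hμ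
  have hR : ∀ z, ∃ᶠ μ in 𝓝 (0 : ℂ),
      IsUnit (rightMulOp (a - algebraMap ℂ A z) - algebraMap ℂ (A →L[ℂ] A) μ) := fun z =>
    (frequently_isUnit_sub h z).mono fun μ hμ => by
      rw [← rightMulOp_sub_algebraMap]; exact isUnit_rightMulOp hμ
  refine ⟨?_, ?_, ?_, ?_, ?_, ?_⟩ <;> refine derivedSpectrum_eq_derivedSpectrum fun z => ?_
  · rw [← leftMulOp_sub_algebraMap]
    exact ⟨fun hd => hd.leftMulOp.isLeftDrazin, fun hl =>
      isDrazinInvertible_of_leftMulOp (exists_range_ker_eq_of_isLeftDrazin (hL z) hl)⟩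
  · rw [← leftMulOp_sub_algebraMap]
    exact ⟨fun hd => hd.leftMulOp.isRightDrazin, fun hr => isDrazinInvertible_of_leftMulOp
      (exists_range_ker_eq_of_opDescent_lt_top (hL z) (IsRightDrazin.opDescent_lt_top hr))⟩
  · rw [← leftMulOp_sub_algebraMap]
    exact ⟨fun hd => hd.leftMulOp.isRightDrazin.opDescent_lt_top, fun hr =>
      isDrazinInvertible_of_leftMulOp (exists_range_ker_eq_of_opDescent_lt_top (hL z) hr)⟩
  · rw [← rightMulOp_sub_algebraMap]
    exact ⟨fun hd => hd.rightMulOp.isLeftDrazin, fun hl =>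
      isDrazinInvertible_of_rightMulOp (exists_range_ker_eq_of_isLeftDrazin (hR z) hl)⟩
  · rw [← rightMulOp_sub_algebraMap]
    exact ⟨fun hd => hd.rightMulOp.isRightDrazin, fun hr => isDrazinInvertible_of_rightMulOp
      (exists_range_ker_eq_of_opDescent_lt_top (hR z) (IsRightDrazin.opDescent_lt_top hr))⟩
  · rw [← rightMulOp_sub_algebraMap]
    exact ⟨fun hd => hd.rightMulOp.isRightDrazin.opDescent_lt_top, fun hr =>
      isDrazinInvertible_of_rightMulOp (exists_range_ker_eq_of_opDescent_lt_top (hR z) hr)⟩
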